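/- Let $\mathcal H$ be a real Hilbert space and let $\beta \ge 0$. Let $f:\mathcal H\to\mathbb R$ be a convex, twice continuously differentiable function with $\inf_{\mathcal H} f>-\infty$, such that $\nabla f:\mathcal H\to\mathcal H$ and $\nabla^2 f:\mathcal H\to\mathcal L(\mathcal H,\mathcal H)$ (with the operator norm) are Lipschitz continuous on the bounded subsets of $\mathcal H$. Let $\phi:\mathcal H\to\mathbb R_+$ be a damping potential, that is: $\phi$ is nonnegative, convex and continuous; $\phi(0)=0=\min_{\mathcal H}\phi$; and for every $R>0$, $\sup_{\|u\|\le R}\|(\partial\phi)^0(u)\|<+\infty$, where $\partial\phi(u)=\{p\in\mathcal H:\ \phi(v)\ge\phi(u)+\langle p,v-u\rangle \text{ for all } v\in\mathcal H\}$ and $(\partial\phi)^0(u)$ is the element of minimal norm of $\partial\phi(u)$. Then for any Cauchy data $(x_0,x_1)\in\mathcal H\times\mathcal H$ there exists a unique strong global solution $x:[0,+\infty[\to\mathcal H$ of $$\text{(ADIGE-VH)}\qquad \ddot x(t)+\partial\phi(\dot x(t))+\beta\nabla^2 f(x(t))\dot x(t)+\nabla f(x(t))\ni 0$$ satisfying $x(0)=x_0$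 and $\dot x(0)=x_1$. Here a strong global solution is a function $x\in\mathcal C^1([0,+\infty[;\mathcal H)$ such that, for every $T>0$, $\dot x$ is Lipschitz continuous on $[0,T]$ and $\ddot x\in L^\infty(0,T;\mathcal H)$, and such that, for almost every $t>0$, $\dot x$ is differentiable at $t$ and the inclusion holds at $t$. -/

import Mathlib

open Set MeasureTheory
open scoped ENNReal

noncomputable section

/-- The (convex) subdifferential `∂φ(u)` of a real-valued function on a Hilbert space. -/
def subdifferential {H : Type*} [NormedAddCommGroup H] [InnerProductSpace ℝ H]
    (φ : H → ℝ) (u : H) : Set H :=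
  {p | ∀ v : H, φ u + inner ℝ p (v - u) ≤ φ v}

/-- `p` is the value at `u` of the minimal section `(∂φ)⁰`: the element of minimal norm
of `∂φ(u)`. -/
def IsMinimalSection {H : Type*} [NormedAddCommGroup H] [InnerProductSpace ℝ H]
    (φ : H → ℝ) (u p : H) : Prop :=
  p ∈ subdifferential φ u ∧ ∀ q ∈ subdifferential φ u, ‖p‖ ≤ ‖q‖

/-- Damping potentials: nonnegative convex continuous functions that attain their minimum `0` at
the origin and for which `sup_{‖u‖ ≤ R} ‖(∂φ)⁰(u)‖ < ∞` for every `R > 0`. -/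
structure IsDampingPotential {H : Type*} [NormedAddCommGroup H] [InnerProductSpace ℝ H]
    (φ : H → ℝ) : Prop where
  nonneg : ∀ u, 0 ≤ φ u
  convex : ConvexOn ℝ univ φ
  continuous : Continuous φ
  map_zero : φ 0 = 0
  bdd_minimalSection : ∀ R : ℝ, 0 < R →
    BddAbove {r : ℝ | ∃ u p : H, ‖u‖ ≤ R ∧ IsMinimalSection φ u p ∧ r = ‖p‖}

/-- Lipschitz continuity on the bounded subsets. -/
def LipschitzOnBoundedSets {E F : Type*} [NormedAddCommGroup E] [NormedAddCommGroup F]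
    (g : E → F) : Prop :=
  ∀ B : Set E, Bornology.IsBounded B → ∃ K : NNReal, LipschitzOnWith K g B

/-- The Hessian `∇²f(x)`, as a bounded operator: the derivative of the gradient. -/
def hessian {H : Type*} [NormedAddCommGroup H] [InnerProductSpace ℝ H] [CompleteSpace H]
    (f : H → ℝ) (x : H) : H →L[ℝ] H :=
  fderiv ℝ (gradient f) x

/-- The velocity `ẋ` of a trajectory on `[0, ∞)` (one-sided derivative at `0`). -/
def velocity {H : Type*} [NormedAddCommGroup H] [InnerProductSpace ℝ H]
    (x : ℝ → H) : ℝ → H :=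
  derivWithin x (Ici 0)

/-- The acceleration `ẍ`, the derivative of the velocity; only its values at points `t > 0` where
the velocity is differentiable are meaningful. -/
def acceleration {H : Type*} [NormedAddCommGroup H] [InnerProductSpace ℝ H]
    (x : ℝ → H) : ℝ → H :=
  deriv (velocity x)

/-- `x`, restricted to `[0, ∞)`, is a strong global solution of
`ẍ(t) + ∂φ(ẋ(t)) + β ∇²f(x(t)) ẋ(t) + ∇f(x(t)) ∋ 0`. Only the values of `x` on `[0, ∞)` matter. -/
structure IsStrongGlobalSolution {H : Type*} [NormedAddCommGroup H] [InnerProductSpace ℝ H]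
    [CompleteSpace H] (f φ : H → ℝ) (β : ℝ) (x : ℝ → H) : Prop where
  contDiffOn : ContDiffOn ℝ 1 x (Ici 0)
  lipschitz_velocity : ∀ T : ℝ, 0 < T →
    ∃ K : NNReal, LipschitzOnWith K (velocity x) (Icc 0 T)
  memLp_acceleration : ∀ T : ℝ, 0 < T → MemLp (acceleration x) ∞ (volume.restrict (Ioo 0 T))
  inclusion : ∀ᵐ t : ℝ, 0 < t →
    DifferentiableAt ℝ (velocity x) t ∧
    ∃ ξ ∈ subdifferential φ (velocity x t),
      acceleration x t + ξ + β • hessian f (x t) (velocity x t) + gradient f (x t) = 0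

end

/-! The equation is the first-order system `ẋ = u`, `u̇ ∈ -(∂φ(u) + F(x, u))`, with `F(x, u) = β
∇²f(x)u + ∇f(x)` Lipschitz on bounded sets. Since `∂φ` is monotone, the squared distance between two
solutions `(x, u)` and `(y, v)` in a common ball satisfies `D' ≤ K D`, whence uniqueness by
Gronwall. The same inequality survives small evaluation errors (`inner_approx_le`) and also drives
existence.

For existence, replace `∂φ` by its minimal section `s`, bounded on bounded sets, and run explicit
Euler. The energy `½‖u‖² + f(x)` is dissipated by the damping and by the nonnegative Hessian, so a
step raises it by `O(h²)` only. As `f` is bounded below, this bounds the scheme on `[0, T]` for all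
small `h` (`exists_euler_bound`). Gronwall then makes the polygons Cauchy, locally uniformly
(`IsApproxSolution.dist_sq_le`).

The limit velocity is Lipschitz, hence differentiable almost everywhere by Rademacher's theorem in
Hilbert space. The section `s` need not be continuous, so the inclusion is not obtained by taking
limits of `s`: the subgradient inequality, tested against a fixed `v`, becomes a growth bound on `‖U
- v‖²`, which is stable under uniform limits (`IsApproxLimit.mem_subdifferential`). -/

open Filter Topology

/-! ### Subgradients, monotonicity and the Hessian of a convex function. -/

section ConvexAnalysis

variable {H : Type*} [NormedAddCommGroup H] [InnerProductSpace ℝ H]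

/-- A continuous convex function on a Hilbert space has a subgradient at every point. -/
theorem subdifferential_nonempty [CompleteSpace H] {φ : H → ℝ} (hconv : ConvexOn ℝ univ φ)
    (hcont : Continuous φ) (u : H) : (subdifferential φ u).Nonempty := by
  have hopen : IsOpen {p : H × ℝ | p.1 ∈ (univ : Set H) ∧ φ p.1 < p.2} := by
    simpa using isOpen_lt (hcont.comp continuous_fst) continuous_snd
  -- Separate `(u, φ u)` from the open strict epigraph. The vertical slope `c` is negative, so
  -- dividing the horizontal part by `-c` gives a subgradient.
  obtain ⟨ℓ, hℓ⟩ := geometric_hahn_banach_open_point hconv.convex_strict_epigraph hopen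
    (x := (u, φ u)) (by simp)
  have hsplit : ∀ (v : H) (r : ℝ), ℓ (v, r) = ℓ (v, 0) + r * ℓ (0, 1) := by
    intro v r
    have : ((v, r) : H × ℝ) = (v, 0) + r • ((0, 1) : H × ℝ) := by simp
    rw [this, map_add, map_smul, smul_eq_mul]
  set c := ℓ (0, 1) with hc
  have hcneg : c < 0 := by
    have := hℓ (u, φ u + 1) ⟨mem_univ _, by simp⟩
    rw [hsplit u (φ u + 1), hsplit u (φ u)] at this
    linarith
  let m : StrongDual ℝ H := (-c)⁻¹ • ℓ.comp (ContinuousLinearMap.inl ℝ H ℝ)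
  have hm : ∀ v, m v = (-c)⁻¹ * ℓ (v, 0) := fun v => by simp [m]
  refine ⟨(InnerProductSpace.toDual ℝ H).symm m, fun v => ?_⟩
  rw [InnerProductSpace.toDual_symm_apply, map_sub, hm, hm]
  refine le_of_forall_pos_le_add fun ε hε => ?_
  have h := hℓ (v, φ v + ε) ⟨mem_univ _, by simpa using hε⟩
  rw [hsplit v, hsplit u (φ u)] at h
  have hc' : 0 < -c := by linarith
  have h2 : ℓ (v, 0) - ℓ (u, 0) ≤ (-c) * (φ v + ε - φ u) := by linarith
  have h3 : (-c)⁻¹ * (ℓ (v, 0) - ℓ (u, 0)) ≤ φ v + ε - φ u := by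
    rw [inv_mul_le_iff₀ hc']; exact h2
  linarith

theorem isClosed_subdifferential (φ : H → ℝ) (u : H) : IsClosed (subdifferential φ u) := by
  simp only [subdifferential, ofPred_forall]
  exact isClosed_iInter fun v => isClosed_le (by fun_prop) (by fun_prop)

theorem convex_subdifferential (φ : H → ℝ) (u : H) : Convex ℝ (subdifferential φ u) := by
  intro p hp q hq a b ha hb hab v
  have h1 := mul_le_mul_of_nonneg_left (hp v) ha
  have h2 := mul_le_mul_of_nonneg_left (hq v) hb
  rw [inner_add_left, real_inner_smul_left, real_inner_smul_left]
  have : b = 1 - a := by linarith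
  subst this
  linarith

theorem exists_isMinimalSection [CompleteSpace H] {φ : H → ℝ} (hconv : ConvexOn ℝ univ φ)
    (hcont : Continuous φ) (u : H) : ∃ p, IsMinimalSection φ u p := by
  obtain ⟨p, hp, hmin⟩ := exists_norm_eq_iInf_of_complete_convex
    (subdifferential_nonempty hconv hcont u) (isClosed_subdifferential φ u).isComplete
    (convex_subdifferential φ u) 0
  refine ⟨p, hp, fun q hq => ?_⟩
  have hbdd : BddBelow (range fun w : subdifferential φ u => ‖(0 : H) - w‖) :=
    ⟨0, by rintro _ ⟨w, rfl⟩; exact norm_nonneg _⟩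
  have := hmin ▸ ciInf_le hbdd ⟨q, hq⟩
  simpa using this

theorem inner_sub_nonneg_of_mem_subdifferential {φ : H → ℝ} {u v p q : H}
    (hp : p ∈ subdifferential φ u) (hq : q ∈ subdifferential φ v) :
    0 ≤ inner ℝ (p - q) (u - v) := by
  have h1 := hp v
  have h2 := hq u
  rw [← neg_sub u v, inner_neg_right] at h1
  rw [inner_sub_left]
  linarith

variable [CompleteSpace H]

/-- The gradient of a differentiable convex function is a subgradient. -/
theorem gradient_mem_subdifferential {f : H → ℝ} (hf : ConvexOn ℝ univ f)
    (hd : Differentiable ℝ f) (x : H) : gradient f x ∈ subdifferential f x := by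
  intro y
  let g : ℝ → ℝ := fun t => f (AffineMap.lineMap x y t)
  have hg : ConvexOn ℝ univ g := hf.comp_affineMap (AffineMap.lineMap x y)
  have hderiv : HasDerivAt g (inner ℝ (gradient f x) (y - x)) 0 := by
    have h1 : HasFDerivAt f (fderiv ℝ f x) (AffineMap.lineMap x y (0 : ℝ)) := by
      simpa using (hd x).hasFDerivAt
    have h2 := h1.comp_hasDerivAt (0 : ℝ) (AffineMap.hasDerivAt_lineMap (a := x) (b := y))
    have h3 : inner ℝ (gradient f x) (y - x) = fderiv ℝ f x (y - x) := by
      rw [gradient, InnerProductSpace.toDual_symm_apply]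
    rw [h3]; exact h2
  have := hg.le_slope_of_hasDerivAt (mem_univ 0) (mem_univ 1) one_pos hderiv
  simp only [slope, g, sub_zero, inv_one, one_smul, vsub_eq_sub, AffineMap.lineMap_apply_one,
    AffineMap.lineMap_apply_zero] at this
  linarith

theorem ContDiff.gradient {f : H → ℝ} (hf : ContDiff ℝ 2 f) : ContDiff ℝ 1 (gradient f) := by
  have h : ContDiff ℝ 1 (fderiv ℝ f) := hf.fderiv_right (by norm_num)
  exact ((InnerProductSpace.toDual ℝ H).symm.toContinuousLinearEquiv.contDiff).comp h

/-- The Hessian of a convex function is a nonnegative quadratic form. -/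
theorem inner_hessian_nonneg {f : H → ℝ} (hf : ConvexOn ℝ univ f) (hf2 : ContDiff ℝ 2 f)
    (x u : H) : 0 ≤ inner ℝ (hessian f x u) u := by
  have hd : Differentiable ℝ f := hf2.differentiable (by norm_num)
  have hg : HasFDerivAt (gradient f) (hessian f x) x :=
    (hf2.gradient.differentiable (by norm_num) x).hasFDerivAt
  -- Monotonicity of the gradient makes these difference quotients, tested against `u`, nonnegative
  -- for `t > 0`.
  have h1 : Tendsto (fun t : ℝ => inner ℝ (t⁻¹ • (gradient f (x + t • u) - gradient f x)) u)
      (𝓝[>] 0) (𝓝 (inner ℝ (hessian f x u) u)) := by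
    have h2 := (hg.hasLineDerivAt u).tendsto_slope_zero_right
    exact (Continuous.tendsto (f := fun w : H => inner ℝ w u) (by fun_prop) _).comp h2
  refine ge_of_tendsto h1 ?_
  filter_upwards [self_mem_nhdsWithin] with t ht
  have ht : (0 : ℝ) < t := ht
  have h3 := inner_sub_nonneg_of_mem_subdifferential
    (gradient_mem_subdifferential hf hd (x + t • u)) (gradient_mem_subdifferential hf hd x)
  rw [add_sub_cancel_left, real_inner_smul_right] at h3
  rw [real_inner_smul_left]
  exact mul_nonneg (by positivity) (nonneg_of_mul_nonneg_right h3 ht)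

end ConvexAnalysis

/-! ### Almost everywhere differentiability of Lipschitz curves. -/

section Rademacher

variable {E : Type*} [NormedAddCommGroup E] [InnerProductSpace ℝ E]

theorem Orthonormal.countable [TopologicalSpace.SeparableSpace E] {ι : Type*} {b : ι → E}
    (hb : Orthonormal ℝ b) : Countable ι := by
  rw [← countable_univ_iff]
  refine PairwiseDisjoint.countable_of_isOpen (s := fun i => Metric.ball (b i) (1 / 2)) ?_
    (fun _ _ => Metric.isOpen_ball) fun i _ => ⟨b i, by simp⟩
  intro i _ j _ hij
  refine Metric.ball_disjoint_ball ?_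
  have h : ‖b i - b j‖ ^ 2 = 2 := by
    rw [norm_sub_sq_real, hb.1, hb.1, hb.2 hij]; norm_num
  rw [dist_eq_norm]
  nlinarith [norm_nonneg (b i - b j)]

variable [CompleteSpace E]

/-- The countably many coordinates in a Hilbert basis are differentiable almost everywhere
simultaneously. Their derivatives assemble into a bounded measurable field `W` of which `u` is a
primitive, and Lebesgue differentiation concludes. -/
theorem LipschitzWith.ae_differentiableAt_of_separable [TopologicalSpace.SeparableSpace E]
    {u : ℝ → E} {K : NNReal} (hu : LipschitzWith K u) : ∀ᵐ t, DifferentiableAt ℝ u t := by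
  obtain ⟨w, b, -⟩ := exists_hilbertBasis ℝ E
  have hcount : Countable w := b.orthonormal.countable
  let g : w → ℝ → ℝ := fun i t => deriv (fun s => inner ℝ (b i) (u s)) t
  have hlip : ∀ i, LipschitzWith K (fun s => inner ℝ (b i) (u s)) := by
    intro i
    refine LipschitzWith.of_dist_le_mul fun s t => ?_
    rw [Real.dist_eq, ← inner_sub_right]
    calc |inner ℝ (b i) (u s - u t)| ≤ ‖b i‖ * ‖u s - u t‖ := abs_real_inner_le_norm _ _
      _ = dist (u s) (u t) := by rw [b.orthonormal.1, one_mul, dist_eq_norm]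
      _ ≤ K * dist s t := hu.dist_le_mul s t
  have hdiff : ∀ᵐ t, ∀ i, HasDerivAt (fun s => inner ℝ (b i) (u s)) (g i t) t := by
    rw [ae_all_iff]
    intro i
    filter_upwards [(hlip i).ae_differentiableAt_real] with t ht using ht.hasDerivAt
  -- Bessel's inequality for the difference quotients, whose norms are at most `K`, passes to the
  -- limit on each finite set of coordinates.
  have hsq : ∀ᵐ t, ∀ F : Finset w, ∑ i ∈ F, ‖g i t‖ ^ 2 ≤ (K : ℝ) ^ 2 := by
    filter_upwards [hdiff] with t ht F
    have hlim : Tendsto (fun h : ℝ => ∑ i ∈ F, ‖inner ℝ (b i) (h⁻¹ • (u (t + h) - u t))‖ ^ 2)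
        (𝓝[≠] 0) (𝓝 (∑ i ∈ F, ‖g i t‖ ^ 2)) := by
      refine tendsto_finsetSum _ fun i _ => ?_
      have := (hasDerivAt_iff_tendsto_slope_zero.1 (ht i)).norm.pow 2
      refine this.congr fun h => ?_
      rw [real_inner_smul_right, inner_sub_right, smul_eq_mul]
    refine le_of_tendsto hlim ?_
    filter_upwards [self_mem_nhdsWithin] with h hh
    have hh : h ≠ 0 := hh
    refine (b.orthonormal.sum_inner_products_le _).trans ?_
    have : ‖h⁻¹ • (u (t + h) - u t)‖ ≤ K := by
      rw [norm_smul, norm_inv, inv_mul_le_iff₀ (norm_pos_iff.2 hh)]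
      have := hu.dist_le_mul (t + h) t
      rw [dist_eq_norm, dist_eq_norm, add_sub_cancel_left] at this
      linarith
    gcongr
  let W : ℝ → E := fun t => ∑' i, g i t • b i
  have hW : ∀ᵐ t, HasSum (fun i => g i t • b i) (W t) ∧ ‖W t‖ ≤ K := by
    filter_upwards [hsq] with t ht
    have hs : Summable fun i => ‖g i t‖ ^ 2 := summable_of_sum_le (fun _ => by positivity) ht
    have hs' : Memℓp (fun i => g i t) 2 := by
      refine memℓp_gen ?_
      simpa using hs
    have h := b.hasSum_repr_symm ⟨_, hs'⟩
    have hS : HasSum (fun i => g i t • b i) (W t) := h.summable.hasSum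
    refine ⟨hS, ?_⟩
    refine le_of_tendsto hS.norm (Eventually.of_forall fun F => ?_)
    refine abs_le_of_sq_le_sq' ?_ K.2 |>.2
    have := b.orthonormal.inner_sum (fun i => g i t) (fun i => g i t) F
    rw [real_inner_self_eq_norm_sq] at this
    rw [this]
    refine le_trans (le_of_eq ?_) (ht F)
    exact Finset.sum_congr rfl fun i _ => by simp [sq]
  have hWmeas : AEStronglyMeasurable W volume := by
    refine aestronglyMeasurable_of_tendsto_ae (atTop : Filter (Finset w))
      (f := fun F t => ∑ i ∈ F, g i t • b i) (fun F => ?_) ?_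
    · refine Finset.aestronglyMeasurable_fun_sum F fun i _ => ?_
      exact (stronglyMeasurable_deriv _).aestronglyMeasurable.smul_const _
    · filter_upwards [hW] with t ht using ht.1
  have hWint : ∀ a c : ℝ, IntervalIntegrable W volume a c := by
    intro a c
    refine (intervalIntegrable_const (c := (K : ℝ))).mono_fun hWmeas.restrict ?_
    filter_upwards [ae_restrict_of_ae hW] with t ht
    simpa using ht.2
  have hWloc : LocallyIntegrable W volume := by
    rw [locallyIntegrable_iff]
    intro k hk
    refine Measure.integrableOn_of_bounded (M := K) hk.measure_lt_top.ne hWmeas ?_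
    filter_upwards [ae_restrict_of_ae hW] with t ht using ht.2
  have hFTC : ∀ t, u t = u 0 + ∫ s in (0 : ℝ)..t, W s := by
    intro t
    refine b.repr.injective ?_
    ext i
    rw [b.repr_apply_apply, b.repr_apply_apply, inner_add_right]
    have h1 : inner ℝ (b i) (∫ s in (0 : ℝ)..t, W s) = ∫ s in (0 : ℝ)..t, g i s := by
      have := (innerSL ℝ (b i)).intervalIntegral_comp_comm (hWint 0 t)
      rw [innerSL_apply_apply] at this
      rw [← this]
      refine intervalIntegral.integral_congr_ae ?_
      filter_upwards [hW] with s hs _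
      have h2 := hs.1.mapL (innerSL ℝ (b i))
      have h3 := h2.unique (hasSum_single i fun j hj => by
        simp [b.orthonormal.2 hj.symm])
      rw [h3]
      simp [b.orthonormal.1 i]
    have h4 := ((hlip i).lipschitzOnWith (s := uIcc 0 t)).absolutelyContinuousOnInterval
      |>.integral_deriv_eq_sub
    rw [h1, h4]; ring
  filter_upwards [LocallyIntegrable.ae_hasDerivAt_integral hWloc] with t ht
  have h := ((ht 0).const_add (u 0)).differentiableAt
  rwa [show u = fun t => u 0 + ∫ s in (0 : ℝ)..t, W s from funext hFTC]

/-- **Rademacher's theorem** for curves in a Hilbert space. -/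
theorem LipschitzWith.ae_differentiableAt_hilbert {u : ℝ → E} {K : NNReal}
    (hu : LipschitzWith K u) : ∀ᵐ t, DifferentiableAt ℝ u t := by
  -- The curve lives in the closed span of its range, which is separable even if `E` is not.
  let V : Submodule ℝ E := (Submodule.span ℝ (range u)).topologicalClosure
  have hmem : ∀ t, u t ∈ V := fun t =>
    Submodule.le_topologicalClosure _ (Submodule.subset_span (mem_range_self t))
  have : CompleteSpace V :=
    (Submodule.isClosed_topologicalClosure (Submodule.span ℝ (range u))).completeSpace_coe
  have hsep : TopologicalSpace.IsSeparable (V : Set E) :=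
    ((TopologicalSpace.isSeparable_range hu.continuous).span (R := ℝ)).closure
  have : TopologicalSpace.SeparableSpace V := hsep.separableSpace
  let u' : ℝ → V := fun t => ⟨u t, hmem t⟩
  have hu' : LipschitzWith K u' := fun s t => hu s t
  filter_upwards [hu'.ae_differentiableAt_of_separable] with t ht
  exact V.subtypeL.differentiableAt.comp t ht

theorem LipschitzOnWith.ae_differentiableAt_hilbert {u : ℝ → E} {K : NNReal} {a b : ℝ}
    (hu : LipschitzOnWith K u (Icc a b)) : ∀ᵐ t, t ∈ Ioo a b → DifferentiableAt ℝ u t := by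
  rcases lt_or_ge b a with hab | hab
  · exact Eventually.of_forall fun t ht => absurd (ht.1.trans ht.2) (by linarith)
  have h : LipschitzWith K (fun t => u (projIcc a b hab t)) := by
    simpa [Function.comp_def] using hu.to_restrict.comp (LipschitzWith.projIcc hab)
  filter_upwards [h.ae_differentiableAt_hilbert] with t ht htab
  refine ht.congr_of_eventuallyEq ?_
  filter_upwards [Ioo_mem_nhds htab.1 htab.2] with s hs
  rw [projIcc_of_mem hab (Ioo_subset_Icc_self hs)]

end Rademacher

/-! ### Piecewise affine interpolation. -/

section Polygon

variable {E : Type*} [NormedAddCommGroup E] [NormedSpace ℝ E]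

/-- The piecewise affine interpolation of the values `z n` at the nodes `n * h`. -/
noncomputable def polygon (h : ℝ) (z : ℕ → E) (t : ℝ) : E :=
  z ⌊t / h⌋₊ + (t / h - ⌊t / h⌋₊) • (z (⌊t / h⌋₊ + 1) - z ⌊t / h⌋₊)

/-- The right node is included although the floor jumps there, because adjacent pieces agree; left
continuity rests on this. -/
theorem polygon_eq {h : ℝ} (hh : 0 < h) (z : ℕ → E) (n : ℕ) {t : ℝ} (h1 : n * h ≤ t)
    (h2 : t ≤ (n + 1) * h) : polygon h z t = z n + (t / h - n) • (z (n + 1) - z n) := by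
  rcases h2.eq_or_lt with rfl | h2
  · have : (n + 1 : ℝ) * h / h = ((n + 1 : ℕ) : ℝ) := by
      rw [mul_div_cancel_right₀ _ hh.ne']; push_cast; rfl
    rw [polygon, this, Nat.floor_natCast]
    simp
  · have hn : ⌊t / h⌋₊ = n := by
      rw [Nat.floor_eq_iff (div_nonneg ((by positivity : (0 : ℝ) ≤ n * h).trans h1) hh.le),
        le_div_iff₀ hh, div_lt_iff₀ hh]
      exact ⟨h1, h2⟩
    simp [polygon, hn]

theorem floor_div_mul_le {h t : ℝ} (hh : 0 < h) (ht : 0 ≤ t) : (⌊t / h⌋₊ : ℝ) * h ≤ t :=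
  (le_div_iff₀ hh).1 (Nat.floor_le (div_nonneg ht hh.le))

theorem lt_floor_div_add_one_mul {h t : ℝ} (hh : 0 < h) : t < ((⌊t / h⌋₊ : ℝ) + 1) * h :=
  (div_lt_iff₀ hh).1 (Nat.lt_floor_add_one _)

@[simp] theorem polygon_zero (h : ℝ) (z : ℕ → E) : polygon h z 0 = z 0 := by
  simp [polygon]

theorem hasDerivWithinAt_polygon {h : ℝ} (hh : 0 < h) (z : ℕ → E) {t : ℝ} (ht : 0 ≤ t) :
    HasDerivWithinAt (polygon h z) (h⁻¹ • (z (⌊t / h⌋₊ + 1) - z ⌊t / h⌋₊)) (Ici t) t := by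
  set n := ⌊t / h⌋₊
  have h1 : (n : ℝ) * h ≤ t := floor_div_mul_le hh ht
  have h2 : t < (n + 1 : ℝ) * h := lt_floor_div_add_one_mul hh
  have hd : HasDerivAt (fun s : ℝ => z n + (s / h - n) • (z (n + 1) - z n))
      (h⁻¹ • (z (n + 1) - z n)) t := by
    have := ((((hasDerivAt_id t).div_const h).sub_const (n : ℝ)).smul_const
      (z (n + 1) - z n)).const_add (z n)
    simpa using this
  refine hd.hasDerivWithinAt.congr_of_eventuallyEq ?_ (polygon_eq hh z n h1 h2.le)
  filter_upwards [Ico_mem_nhdsGE h2] with s hs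
  exact polygon_eq hh z n (h1.trans hs.1) hs.2.le

theorem continuousOn_polygon {h : ℝ} (hh : 0 < h) (z : ℕ → E) :
    ContinuousOn (polygon h z) (Ici 0) := by
  intro t ht
  have hr := (hasDerivWithinAt_polygon hh z ht).continuousWithinAt
  rcases (mem_Ici.1 ht).eq_or_lt with rfl | h0
  · exact hr
  refine ContinuousAt.continuousWithinAt (continuousAt_iff_continuous_left_right.2 ⟨?_, hr⟩)
  obtain ⟨n, h1, h2⟩ : ∃ n : ℕ, (n : ℝ) * h < t ∧ t ≤ (n + 1) * h := by
    obtain ⟨n, hn⟩ : ∃ n : ℕ, ⌈t / h⌉₊ = n + 1 :=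
      Nat.exists_eq_succ_of_ne_zero (Nat.ceil_pos.2 (div_pos h0 hh)).ne'
    have := (Nat.ceil_eq_iff (Nat.succ_ne_zero n)).1 hn
    refine ⟨n, (lt_div_iff₀ hh).1 (by simpa using this.1), (div_le_iff₀ hh).1 ?_⟩
    simpa using this.2
  have hc : Continuous fun s : ℝ => z n + (s / h - n) • (z (n + 1) - z n) := by fun_prop
  refine hc.continuousWithinAt.congr_of_eventuallyEq ?_ (polygon_eq hh z n h1.le h2)
  filter_upwards [Ioc_mem_nhdsLE h1] with s hs
  exact polygon_eq hh z n hs.1.le (hs.2.trans h2)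

theorem norm_polygon_sub_le {h : ℝ} (hh : 0 < h) (z : ℕ → E) {t : ℝ} (ht : 0 ≤ t) :
    ‖polygon h z t - z ⌊t / h⌋₊‖ ≤ ‖z (⌊t / h⌋₊ + 1) - z ⌊t / h⌋₊‖ := by
  have h1 := Nat.floor_le (div_nonneg ht hh.le)
  have h2 := (Nat.lt_floor_add_one (t / h)).le
  rw [polygon, add_sub_cancel_left, norm_smul]
  refine mul_le_of_le_one_left (norm_nonneg _) ?_
  rw [Real.norm_eq_abs, abs_le]
  constructor <;> linarith

end Polygon

/-! ### Maps of two variables that are Lipschitz on balls. -/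

section LipschitzOnBalls

variable {E : Type*} [NormedAddCommGroup E]

/-- Lipschitz continuity, on bounded sets, of a function of two variables. -/
def LipschitzOnBalls (F : E → E → E) : Prop :=
  ∀ R : ℝ, ∃ L : ℝ, 0 ≤ L ∧ ∀ x y u v : E, ‖x‖ ≤ R → ‖y‖ ≤ R → ‖u‖ ≤ R → ‖v‖ ≤ R →
    ‖F x u - F y v‖ ≤ L * (‖x - y‖ + ‖u - v‖)

theorem LipschitzOnBalls.exists_bound {F : E → E → E} (hF : LipschitzOnBalls F) (R : ℝ) :
    ∃ M : ℝ, 0 ≤ M ∧ ∀ x u : E, ‖x‖ ≤ R → ‖u‖ ≤ R → ‖F x u‖ ≤ M := by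
  obtain ⟨L, hL, h⟩ := hF R
  refine ⟨‖F 0 0‖ + L * (|R| + |R|), by positivity, fun x u hx hu => ?_⟩
  have hR : 0 ≤ R := (norm_nonneg x).trans hx
  have h1 := h x 0 u 0 hx (by simpa) hu (by simpa)
  rw [sub_zero, sub_zero] at h1
  have h2 := norm_le_norm_add_norm_sub' (F x u) (F 0 0)
  rw [abs_of_nonneg hR]
  have : L * (‖x‖ + ‖u‖) ≤ L * (R + R) := by gcongr
  linarith

theorem LipschitzOnBalls.continuous {F : E → E → E} (hF : LipschitzOnBalls F) :
    Continuous fun p : E × E => F p.1 p.2 := by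
  rw [continuous_iff_continuousAt]
  intro p
  obtain ⟨L, hL, h⟩ := hF (‖p‖ + 1)
  refine tendsto_iff_norm_sub_tendsto_zero.2 ?_
  refine squeeze_zero' (g := fun q : E × E => L * (‖q.1 - p.1‖ + ‖q.2 - p.2‖))
    (Eventually.of_forall fun _ => norm_nonneg _) ?_ ?_
  · filter_upwards [Metric.ball_mem_nhds p one_pos] with q hq
    have hq : ‖q‖ ≤ ‖p‖ + 1 := by
      rw [mem_ball_iff_norm] at hq
      linarith [norm_le_norm_add_norm_sub' q p]
    have hp : ‖p‖ ≤ ‖p‖ + 1 := by linarith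
    exact h _ _ _ _ ((norm_fst_le q).trans hq) ((norm_fst_le p).trans hp)
      ((norm_snd_le q).trans hq) ((norm_snd_le p).trans hp)
  · have : Continuous fun q : E × E => L * (‖q.1 - p.1‖ + ‖q.2 - p.2‖) := by fun_prop
    simpa using this.tendsto p

end LipschitzOnBalls

/-! ### The explicit Euler scheme and its energy estimate. -/

section Euler

variable {H : Type*} [NormedAddCommGroup H] [InnerProductSpace ℝ H]

/-- The explicit Euler scheme for the system `ẋ = u`, `u̇ = -(s(u) + F(x, u))`. -/
noncomputable def euler (s : H → H) (F : H → H → H) (h : ℝ) (x₀ x₁ : H) : ℕ → H × H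
  | 0 => (x₀, x₁)
  | n + 1 => ((euler s F h x₀ x₁ n).1 + h • (euler s F h x₀ x₁ n).2,
      (euler s F h x₀ x₁ n).2 - h • (s (euler s F h x₀ x₁ n).2 +
        F (euler s F h x₀ x₁ n).1 (euler s F h x₀ x₁ n).2))

/-- Approximate solutions, on `[0, T]`, of `ẋ = u`, `u̇ = -(s(u) + F(x, u))`: the right-hand sides
are evaluated at points `(X', U')` at distance at most `e` from `(X, U)`. -/
structure IsApproxSolution (s : H → H) (F : H → H → H) (x₀ x₁ : H) (T R e : ℝ)
    (X U X' U' : ℝ → H) : Prop where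
  left_init : X 0 = x₀
  right_init : U 0 = x₁
  left_cont : ContinuousOn X (Icc 0 T)
  right_cont : ContinuousOn U (Icc 0 T)
  left_deriv : ∀ t ∈ Ico 0 T, HasDerivWithinAt X (U' t) (Ici t) t
  right_deriv : ∀ t ∈ Ico 0 T, HasDerivWithinAt U (-(s (U' t) + F (X' t) (U' t))) (Ici t) t
  left_near : ∀ t ∈ Icc 0 T, ‖X t - X' t‖ ≤ e
  right_near : ∀ t ∈ Icc 0 T, ‖U t - U' t‖ ≤ e
  left_bdd : ∀ t ∈ Icc 0 T, ‖X' t‖ ≤ R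
  right_bdd : ∀ t ∈ Icc 0 T, ‖U' t‖ ≤ R
  force_bdd : ∀ t ∈ Icc 0 T, ‖s (U' t) + F (X' t) (U' t)‖ ≤ R

/-- Euler polygons are approximate solutions as long as the scheme stays bounded. -/
theorem isApproxSolution_polygon {s : H → H} {F : H → H → H} {x₀ x₁ : H} {T R h : ℝ}
    (hh : 0 < h) (hbdd : ∀ n : ℕ, n * h ≤ T →
      ‖(euler s F h x₀ x₁ n).1‖ ≤ R ∧ ‖(euler s F h x₀ x₁ n).2‖ ≤ R ∧
      ‖s (euler s F h x₀ x₁ n).2 + F (euler s F h x₀ x₁ n).1 (euler s F h x₀ x₁ n).2‖ ≤ R) :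
    IsApproxSolution s F x₀ x₁ T R (h * R)
      (polygon h fun n => (euler s F h x₀ x₁ n).1) (polygon h fun n => (euler s F h x₀ x₁ n).2)
      (fun t => (euler s F h x₀ x₁ ⌊t / h⌋₊).1) (fun t => (euler s F h x₀ x₁ ⌊t / h⌋₊).2) := by
  have hb : ∀ t ∈ Icc 0 T, _ := fun t ht =>
    hbdd ⌊t / h⌋₊ ((floor_div_mul_le hh ht.1).trans ht.2)
  refine ⟨by simp [euler], by simp [euler], (continuousOn_polygon hh _).mono Icc_subset_Ici_self,
    (continuousOn_polygon hh _).mono Icc_subset_Ici_self, fun t ht => ?_, fun t ht => ?_,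
    fun t ht => ?_, fun t ht => ?_, fun t ht => (hb t ht).1, fun t ht => (hb t ht).2.1,
    fun t ht => (hb t ht).2.2⟩
  · convert! hasDerivWithinAt_polygon hh (fun n => (euler s F h x₀ x₁ n).1) ht.1 using 1
    simp [euler, smul_smul, hh.ne']
  · convert! hasDerivWithinAt_polygon hh (fun n => (euler s F h x₀ x₁ n).2) ht.1 using 1
    simp only [euler, sub_sub_cancel_left]
    rw [smul_neg, smul_smul, inv_mul_cancel₀ hh.ne', one_smul]
  · refine (norm_polygon_sub_le hh _ ht.1).trans ?_
    simp only [euler, add_sub_cancel_left, norm_smul, Real.norm_eq_abs, abs_of_pos hh]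
    exact mul_le_mul_of_nonneg_left (hb t ht).2.1 hh.le
  · refine (norm_polygon_sub_le hh _ ht.1).trans ?_
    simp only [euler, sub_sub_cancel_left, norm_neg, norm_smul, Real.norm_eq_abs, abs_of_pos hh]
    exact mul_le_mul_of_nonneg_left (hb t ht).2.2 hh.le

section Force

variable [CompleteSpace H]

/-- The Lipschitz part `β ∇²f(x)u + ∇f(x)` of the force. -/
noncomputable def smoothForce (f : H → ℝ) (β : ℝ) (x u : H) : H :=
  β • hessian f x u + gradient f x

theorem lipschitzOnBalls_smoothForce {f : H → ℝ} (β : ℝ)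
    (hf_grad : LipschitzOnBoundedSets (gradient f))
    (hf_hess : LipschitzOnBoundedSets (hessian f)) : LipschitzOnBalls (smoothForce f β) := by
  intro R
  obtain ⟨K, hK⟩ := hf_grad _ (Metric.isBounded_closedBall (x := (0 : H)) (r := R))
  obtain ⟨K', hK'⟩ := hf_hess _ (Metric.isBounded_closedBall (x := (0 : H)) (r := R))
  set B := ‖hessian f 0‖ + K' * |R|
  refine ⟨|β| * (K' * |R|) + |β| * B + K, by positivity, fun x y u v hx hy hu hv => ?_⟩
  have hR : 0 ≤ R := (norm_nonneg x).trans hx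
  have hmem : ∀ z : H, ‖z‖ ≤ R → z ∈ Metric.closedBall (0 : H) R := fun z hz => by simpa
  have h1 := hK.norm_sub_le (hmem x hx) (hmem y hy)
  have h2 := hK'.norm_sub_le (hmem x hx) (hmem y hy)
  have h3 : ‖hessian f y‖ ≤ B := by
    have h4 := hK'.norm_sub_le (hmem y hy) (hmem 0 (by simpa))
    rw [sub_zero] at h4
    have h5 := norm_le_norm_add_norm_sub' (hessian f y) (hessian f 0)
    have : (K' : ℝ) * ‖y‖ ≤ K' * |R| := by rw [abs_of_nonneg hR]; gcongr
    simp only [B]; linarith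
  have hsplit : smoothForce f β x u - smoothForce f β y v
      = β • ((hessian f x - hessian f y) u) + β • (hessian f y (u - v))
        + (gradient f x - gradient f y) := by
    simp only [smoothForce, sub_apply, map_sub, smul_sub]; abel
  rw [hsplit]
  have h6 : ‖β • ((hessian f x - hessian f y) u)‖ ≤ |β| * (K' * |R|) * ‖x - y‖ := by
    rw [norm_smul, Real.norm_eq_abs, mul_assoc, mul_right_comm]
    refine mul_le_mul_of_nonneg_left ?_ (abs_nonneg β)
    refine (ContinuousLinearMap.le_opNorm _ _).trans ?_
    rw [abs_of_nonneg hR]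
    gcongr
  have h7 : ‖β • (hessian f y (u - v))‖ ≤ |β| * B * ‖u - v‖ := by
    rw [norm_smul, Real.norm_eq_abs, mul_assoc]
    refine mul_le_mul_of_nonneg_left ?_ (abs_nonneg β)
    refine (ContinuousLinearMap.le_opNorm _ _).trans ?_
    gcongr
  refine (norm_add₃_le).trans ?_
  have e1 : 0 ≤ |β| * (K' * |R|) * ‖u - v‖ := by positivity
  have e2 : 0 ≤ |β| * B * ‖x - y‖ := by positivity
  have e3 : 0 ≤ K * ‖u - v‖ := by positivity
  linarith

/-- Energy estimate for the Euler scheme: uniform bounds on `[0, T]` for small steps. -/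
theorem exists_euler_bound {f φ : H → ℝ} {β : ℝ} (hβ : 0 ≤ β)
    (hf_convex : ConvexOn ℝ univ f) (hf_C2 : ContDiff ℝ 2 f) (hf_bdd : BddBelow (range f))
    (hf_grad : LipschitzOnBoundedSets (gradient f))
    (hF : LipschitzOnBalls (smoothForce f β))
    (hφ : ∀ u, φ 0 ≤ φ u) {s : H → H} (hs : ∀ u, s u ∈ subdifferential φ u)
    (hs_bdd : ∀ R : ℝ, ∃ M : ℝ, 0 ≤ M ∧ ∀ u, ‖u‖ ≤ R → ‖s u‖ ≤ M) (x₀ x₁ : H) {T : ℝ}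
    (hT : 0 ≤ T) :
    ∃ R h₀ : ℝ, 0 ≤ R ∧ 0 < h₀ ∧ ∀ h : ℝ, 0 < h → h ≤ h₀ → ∀ n : ℕ, n * h ≤ T →
      ‖(euler s (smoothForce f β) h x₀ x₁ n).1‖ ≤ R ∧
      ‖(euler s (smoothForce f β) h x₀ x₁ n).2‖ ≤ R := by
  obtain ⟨m, hm⟩ := hf_bdd
  have hm : ∀ x, m ≤ f x := fun x => hm (mem_range_self x)
  set E₀ := 1 / 2 * ‖x₁‖ ^ 2 + f x₀
  have hE₀ : 0 ≤ E₀ - m := by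
    have := hm x₀
    have : 0 ≤ 1 / 2 * ‖x₁‖ ^ 2 := by positivity
    simp only [E₀]; linarith
  -- `C` bounds the velocity as long as the energy is at most `E₀ + 1`.
  set C := √(2 * (E₀ + 1 - m))
  have hC : 0 ≤ C := Real.sqrt_nonneg _
  have hTC : 0 ≤ T * C := mul_nonneg hT hC
  set R := ‖x₀‖ + T * C + C
  have hR : 0 ≤ R := by positivity
  obtain ⟨M₁, hM₁, hs_bdd⟩ := hs_bdd R
  obtain ⟨M₂, hM₂, hF_bdd⟩ := hF.exists_bound R
  obtain ⟨K, hK⟩ := hf_grad _ (Metric.isBounded_closedBall (x := (0 : H)) (r := R))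
  -- One step raises the energy by at most `A h²`: the first term is kinetic, the second is the
  -- linearization error of `f`.
  set A := (M₁ + M₂) ^ 2 / 2 + K * C ^ 2
  have hA : 0 ≤ A := by positivity
  have hd : Differentiable ℝ f := hf_C2.differentiable (by norm_num)
  -- With this threshold the accumulated error `A h T` stays below `1`.
  refine ⟨R, 1 / (A * T + 1), hR, by positivity, fun h hh hh₀ => ?_⟩
  rw [le_div_iff₀ (by positivity)] at hh₀
  set z := euler s (smoothForce f β) h x₀ x₁
  have hvel : ∀ n : ℕ, n * h ≤ T →
      1 / 2 * ‖(z n).2‖ ^ 2 + f (z n).1 ≤ E₀ + A * h * (n * h) → ‖(z n).2‖ ≤ C := by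
    intro n hn hE
    refine Real.le_sqrt_of_sq_le ?_
    have h1 : A * h * (n * h) ≤ A * h * T := by gcongr
    have := hm (z n).1
    nlinarith
  -- Position and energy are bounded in one induction, because `M₁`, `M₂` and `K` are valid only in
  -- the ball of radius `R`.
  have key : ∀ n : ℕ, n * h ≤ T → ‖(z n).1‖ ≤ ‖x₀‖ + n * h * C ∧
      1 / 2 * ‖(z n).2‖ ^ 2 + f (z n).1 ≤ E₀ + A * h * (n * h) := by
    intro n
    induction n with
    | zero => intro _; simp [z, euler, E₀]
    | succ n ih =>
      intro hn
      push_cast at hn ⊢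
      have hn' : n * h ≤ T := by linarith
      obtain ⟨ihx, ihE⟩ := ih hn'
      have hu := hvel n hn' ihE
      set x := (z n).1
      set u := (z n).2
      set w := s u + smoothForce f β x u with hw
      have hx' : (z (n + 1)).1 = x + h • u := rfl
      have hu' : (z (n + 1)).2 = u - h • w := rfl
      have hnx : ‖x + h • u‖ ≤ ‖x₀‖ + (n + 1) * h * C := by
        refine (norm_add_le _ _).trans ?_
        rw [norm_smul, Real.norm_eq_abs, abs_of_pos hh]
        have : h * ‖u‖ ≤ h * C := by gcongr
        linarith
      have hxR : ‖x‖ ≤ R := by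
        have : n * h * C ≤ T * C := by gcongr
        simp only [R]; linarith
      have hxR' : ‖x + h • u‖ ≤ R := by
        have : (n + 1) * h * C ≤ T * C := by gcongr
        simp only [R]; linarith
      have huR : ‖u‖ ≤ R := by
        have := norm_nonneg x₀
        simp only [R]; linarith
      rw [hx', hu']
      refine ⟨hnx, ?_⟩
      have hwM : ‖w‖ ≤ M₁ + M₂ :=
        (norm_add_le _ _).trans (add_le_add (hs_bdd u huR) (hF_bdd x u hxR huR))
      -- Damping and Hessian terms only dissipate; the remaining power of `∇f` cancels the
      -- first-order growth of `f`.
      have hwu : inner ℝ (gradient f x) u ≤ inner ℝ u w := by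
        have h1 : 0 ≤ inner ℝ (s u) u := by
          have h2 := hs u 0
          rw [zero_sub, inner_neg_right] at h2
          linarith [hφ u]
        have h3 := mul_nonneg hβ (inner_hessian_nonneg hf_convex hf_C2 x u)
        rw [real_inner_comm w u, hw, smoothForce, inner_add_left, inner_add_left,
          real_inner_smul_left]
        linarith
      have hkin : ‖u - h • w‖ ^ 2 ≤ ‖u‖ ^ 2 - 2 * (h * inner ℝ (gradient f x) u)
          + h ^ 2 * (M₁ + M₂) ^ 2 := by
        rw [norm_sub_sq_real, real_inner_smul_right, norm_smul, Real.norm_eq_abs, abs_of_pos hh,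
          mul_pow]
        have h1 : h ^ 2 * ‖w‖ ^ 2 ≤ h ^ 2 * (M₁ + M₂) ^ 2 := by gcongr
        have h2 := mul_le_mul_of_nonneg_left hwu hh.le
        linarith
      -- Convexity at the new point bounds the increment by the gradient there; its Lipschitz
      -- constant brings it back to `x`.
      have hpot : f (x + h • u) ≤ f x + h * inner ℝ (gradient f x) u + h ^ 2 * (K * C ^ 2) := by
        have h1 := gradient_mem_subdifferential hf_convex hd (x + h • u) x
        rw [sub_add_cancel_left, inner_neg_right, real_inner_smul_right] at h1
        have h2 : inner ℝ (gradient f (x + h • u) - gradient f x) u ≤ h * (K * C ^ 2) := by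
          refine (real_inner_le_norm _ _).trans ?_
          have h3 := hK.norm_sub_le (x := x + h • u) (y := x) (by simpa using hxR')
            (by simpa using hxR)
          rw [add_sub_cancel_left, norm_smul, Real.norm_eq_abs, abs_of_pos hh] at h3
          calc _ ≤ K * (h * ‖u‖) * ‖u‖ := by gcongr
            _ ≤ K * (h * C) * C := by gcongr
            _ = _ := by ring
        rw [inner_sub_left] at h2
        have h4 := mul_le_mul_of_nonneg_left h2 hh.le
        linarith
      have hAe : A * h * h = h ^ 2 * (M₁ + M₂) ^ 2 / 2 + h ^ 2 * (K * C ^ 2) := by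
        simp only [A]; ring
      linarith
  intro n hn
  obtain ⟨hx, hE⟩ := key n hn
  have hu := hvel n hn hE
  have h1 : n * h * C ≤ T * C := by gcongr
  have := norm_nonneg x₀
  constructor <;> simp only [R] <;> linarith

end Force

end Euler

/-! ### Stability of approximate solutions and passage to the limit. -/

section ApproxSolution

variable {H : Type*} [NormedAddCommGroup H] [InnerProductSpace ℝ H]

/-- Pointwise differential inequality behind the stability of approximate solutions; the velocity
term is treated by monotonicity of the subdifferential. -/
theorem inner_approx_le {φ : H → ℝ} {F : H → H → H} {L R σ : ℝ} (hL : 0 ≤ L) (hσ : 0 ≤ σ) (hσ2 : σ ≤ 2)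
    {x y u v x' y' u' v' p q : H}
    (hp : p ∈ subdifferential φ u') (hq : q ∈ subdifferential φ v')
    (hF : ‖F x' u' - F y' v'‖ ≤ L * (‖x' - y'‖ + ‖u' - v'‖))
    (hx : ‖(x - x') - (y - y')‖ ≤ σ) (hu : ‖(u - u') - (v - v')‖ ≤ σ)
    (hwu : ‖p + F x' u'‖ ≤ R) (hwv : ‖q + F y' v'‖ ≤ R) :
    2 * inner ℝ (x - y) (u' - v') +
      2 * inner ℝ (u - v) (-(p + F x' u') - -(q + F y' v')) ≤
    (2 + 6 * L) * (‖x - y‖ ^ 2 + ‖u - v‖ ^ 2) + (2 + 16 * L + 4 * R) * σ := by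
  set a := ‖x - y‖
  set b := ‖u - v‖
  have ha : 0 ≤ a := norm_nonneg _
  have hb : 0 ≤ b := norm_nonneg _
  have hA : ‖x' - y'‖ ≤ a + σ := by
    have : x' - y' = (x - y) - ((x - x') - (y - y')) := by abel
    rw [this]; exact (norm_sub_le _ _).trans (by gcongr)
  have hB : ‖u' - v'‖ ≤ b + σ := by
    have : u' - v' = (u - v) - ((u - u') - (v - v')) := by abel
    rw [this]; exact (norm_sub_le _ _).trans (by gcongr)
  have h1 : inner ℝ (x - y) (u' - v') ≤ a * (b + σ) :=
    (real_inner_le_norm _ _).trans (by gcongr)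
  have h2 : inner ℝ (u - v) (-(p + F x' u') - -(q + F y' v')) ≤
      L * ((a + σ + (b + σ)) * (b + σ)) + 2 * R * σ := by
    -- Monotonicity is available at `u'`, `v'`, where the subgradients are taken. Replacing `u - v`
    -- by `u' - v'` costs the bounded total forces times `σ`.
    have hsplit : inner ℝ (u - v) (-(p + F x' u') - -(q + F y' v')) =
        - inner ℝ (p - q) (u' - v') - inner ℝ (F x' u' - F y' v') (u' - v')
        - inner ℝ ((p + F x' u') - (q + F y' v')) ((u - u') - (v - v')) := by
      have : u - v = (u' - v') + ((u - u') - (v - v')) := by abel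
      rw [show -(p + F x' u') - -(q + F y' v')
        = -((p + F x' u') - (q + F y' v')) by abel, inner_neg_right, real_inner_comm]
      nth_rw 1 [this]
      rw [inner_add_right, show (p + F x' u') - (q + F y' v')
        = (p - q) + (F x' u' - F y' v') by abel, inner_add_left _ _ (u' - v')]
      ring
    have h3 := inner_sub_nonneg_of_mem_subdifferential hp hq
    have h4 : - inner ℝ (F x' u' - F y' v') (u' - v') ≤ L * ((a + σ + (b + σ)) * (b + σ)) := by
      rw [← inner_neg_left]
      refine (real_inner_le_norm _ _).trans ?_
      rw [norm_neg, ← mul_assoc]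
      refine mul_le_mul (hF.trans (by gcongr)) hB (norm_nonneg _) (by positivity)
    have h5 : - inner ℝ ((p + F x' u') - (q + F y' v')) ((u - u') - (v - v'))
        ≤ 2 * R * σ := by
      rw [← inner_neg_left]
      refine (real_inner_le_norm _ _).trans ?_
      have hR : 0 ≤ R := (norm_nonneg _).trans hwu
      rw [norm_neg]
      refine mul_le_mul ((norm_sub_le _ _).trans ?_) hu (norm_nonneg _) (by positivity)
      linarith
    rw [hsplit]
    linarith
  have hσσ : σ ^ 2 ≤ 2 * σ := by nlinarith
  have h6 : a * (b + σ) ≤ a ^ 2 + b ^ 2 + σ := by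
    nlinarith [sq_nonneg (a - b), sq_nonneg (a - σ), sq_nonneg b]
  have h7 : (a + σ + (b + σ)) * (b + σ) ≤ 3 * (a ^ 2 + b ^ 2) + 8 * σ := by
    nlinarith [sq_nonneg (a - b), sq_nonneg (a - σ), sq_nonneg (b - σ), sq_nonneg a]
  have h8 := mul_le_mul_of_nonneg_left h7 hL
  linarith

/-- Both pairs start from the same data, so in Gronwall's bound only the evaluation errors remain.
Assuming `e, e' ≤ 1` ensures `σ = e + e' ≤ 2`, which makes the quadratic errors linear. -/
theorem IsApproxSolution.dist_sq_le {φ : H → ℝ} {s : H → H}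
    (hs : ∀ u, s u ∈ subdifferential φ u) {F : H → H → H} (hF : LipschitzOnBalls F)
    (x₀ x₁ : H) {T R : ℝ} (hR : 0 ≤ R) :
    ∃ C : ℝ, 0 ≤ C ∧ ∀ (e e' : ℝ) (X U X' U' Y V Y' V' : ℝ → H), e ≤ 1 → e' ≤ 1 →
      IsApproxSolution s F x₀ x₁ T R e X U X' U' → IsApproxSolution s F x₀ x₁ T R e' Y V Y' V' →
      ∀ t ∈ Icc 0 T, ‖X t - Y t‖ ^ 2 + ‖U t - V t‖ ^ 2 ≤ C * (e + e') := by
  obtain ⟨L, hL, hLip⟩ := hF R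
  set K := 2 + 6 * L
  have hK : 0 < K := by positivity
  set Q := 2 + 16 * L + 4 * R
  have hQ : 0 ≤ Q := by positivity
  refine ⟨Q / K * Real.exp (K * T), by positivity, ?_⟩
  intro e e' X U X' U' Y V Y' V' he1 he1' h h' t ht
  have he : 0 ≤ e := (norm_nonneg _).trans (h.left_near t ht)
  have he' : 0 ≤ e' := (norm_nonneg _).trans (h'.left_near t ht)
  have hder : ∀ τ ∈ Ico 0 T, HasDerivWithinAt
      (fun t => ‖X t - Y t‖ ^ 2 + ‖U t - V t‖ ^ 2)
      (2 * inner ℝ (X τ - Y τ) (U' τ - V' τ) + 2 * inner ℝ (U τ - V τ)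
        (-(s (U' τ) + F (X' τ) (U' τ)) - -(s (V' τ) + F (Y' τ) (V' τ)))) (Ici τ) τ :=
    fun τ hτ => ((h.left_deriv τ hτ).sub (h'.left_deriv τ hτ)).norm_sq.add
      ((h.right_deriv τ hτ).sub (h'.right_deriv τ hτ)).norm_sq
  have hgr := le_gronwallBound_of_liminf_deriv_right_le (δ := 0) (K := K) (ε := Q * (e + e'))
    (((h.left_cont.sub h'.left_cont).norm.pow 2).add ((h.right_cont.sub h'.right_cont).norm.pow 2))
    (fun τ hτ r hr => (hder τ hτ).liminf_right_slope_le hr)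
    (by simp [h.left_init, h'.left_init, h.right_init, h'.right_init]) ?_ t ht
  · refine hgr.trans ?_
    rw [gronwallBound_of_K_ne_0 hK.ne']
    simp only [zero_mul, zero_add, sub_zero]
    have h1 : Real.exp (K * t) - 1 ≤ Real.exp (K * T) := by
      have : Real.exp (K * t) ≤ Real.exp (K * T) := by gcongr; exact ht.2
      linarith
    calc Q * (e + e') / K * (Real.exp (K * t) - 1)
        ≤ Q * (e + e') / K * Real.exp (K * T) := by gcongr
      _ = _ := by ring
  · intro τ hτ
    have hτ' := Ico_subset_Icc_self hτ
    refine inner_approx_le hL (by linarith) (by linarith) (hs _) (hs _)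
      (hLip _ _ _ _ (h.left_bdd τ hτ') (h'.left_bdd τ hτ') (h.right_bdd τ hτ')
        (h'.right_bdd τ hτ')) ?_ ?_ (h.force_bdd τ hτ') (h'.force_bdd τ hτ')
    · exact (norm_sub_le _ _).trans (add_le_add (h.left_near τ hτ') (h'.left_near τ hτ'))
    · exact (norm_sub_le _ _).trans (add_le_add (h.right_near τ hτ') (h'.right_near τ hτ'))

/-- `(x, u)` is a locally uniform limit of uniformly bounded approximate solutions. -/
def IsApproxLimit (s : H → H) (F : H → H → H) (x₀ x₁ : H) (x u : ℝ → H) : Prop :=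
  ∀ T : ℝ, 0 ≤ T → ∃ R : ℝ, 0 ≤ R ∧ ∀ ε : ℝ, 0 < ε → ∃ X U X' U' : ℝ → H,
    IsApproxSolution s F x₀ x₁ T R ε X U X' U' ∧ ∀ t ∈ Icc 0 T,
      ‖X t - x t‖ ≤ ε ∧ ‖U t - u t‖ ≤ ε ∧ ‖X' t - x t‖ ≤ ε ∧ ‖U' t - u t‖ ≤ ε

theorem IsApproxSolution.mono {s : H → H} {F : H → H → H} {x₀ x₁ : H} {T R e e' : ℝ}
    {X U X' U' : ℝ → H} (h : IsApproxSolution s F x₀ x₁ T R e X U X' U') (he : e ≤ e') :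
    IsApproxSolution s F x₀ x₁ T R e' X U X' U' :=
  { h with
    left_near := fun t ht => (h.left_near t ht).trans he
    right_near := fun t ht => (h.right_near t ht).trans he }

theorem exists_isApproxLimit [CompleteSpace H] {φ : H → ℝ} {s : H → H}
    (hs : ∀ u, s u ∈ subdifferential φ u) {F : H → H → H} (hF : LipschitzOnBalls F)
    (x₀ x₁ : H) (X U X' U' : ℕ → ℝ → H)
    (happrox : ∀ T : ℝ, 0 ≤ T → ∃ R : ℝ, 0 ≤ R ∧ ∀ ε : ℝ, 0 < ε → ∀ᶠ k in atTop,
      IsApproxSolution s F x₀ x₁ T R ε (X k) (U k) (X' k) (U' k)) :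
    ∃ x u : ℝ → H, IsApproxLimit s F x₀ x₁ x u := by
  have hcauchy : ∀ T : ℝ, 0 ≤ T → ∀ ε : ℝ, 0 < ε → ∃ N, ∀ k ≥ N, ∀ l ≥ N, ∀ t ∈ Icc 0 T,
      ‖X k t - X l t‖ ≤ ε ∧ ‖U k t - U l t‖ ≤ ε := by
    intro T hT ε hε
    obtain ⟨R, hR, h⟩ := happrox T hT
    obtain ⟨C, hC, hdist⟩ := IsApproxSolution.dist_sq_le hs hF x₀ x₁ (T := T) hR
    -- Chosen so that the stability bound `C * (δ + δ)` is at most `ε ^ 2`.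
    set δ := min 1 (ε ^ 2 / (2 * (C + 1)))
    have hδ : 0 < δ := by positivity
    obtain ⟨N, hN⟩ := eventually_atTop.1 (h δ hδ)
    refine ⟨N, fun k hk l hl t ht => ?_⟩
    have h1 := hdist δ δ _ _ _ _ _ _ _ _ (min_le_left _ _) (min_le_left _ _) (hN k hk) (hN l hl)
      t ht
    have h2 : C * (δ + δ) ≤ ε ^ 2 := by
      have h3 : δ ≤ ε ^ 2 / (2 * (C + 1)) := min_le_right _ _
      rw [le_div_iff₀ (by positivity)] at h3
      nlinarith
    have h4 := sq_nonneg ‖X k t - X l t‖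
    have h5 := sq_nonneg ‖U k t - U l t‖
    exact ⟨(abs_le_of_sq_le_sq' (by linarith) hε.le).2, (abs_le_of_sq_le_sq' (by linarith) hε.le).2⟩
  have hlim : ∀ t : ℝ, ∃ x u : H, 0 ≤ t →
      Tendsto (fun k => X k t) atTop (𝓝 x) ∧ Tendsto (fun k => U k t) atTop (𝓝 u) := by
    intro t
    by_cases ht : 0 ≤ t
    · have hX : CauchySeq fun k => X k t := by
        rw [Metric.cauchySeq_iff]
        intro ε hε
        obtain ⟨N, hN⟩ := hcauchy t ht (ε / 2) (by positivity)
        refine ⟨N, fun k hk l hl => ?_⟩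
        rw [dist_eq_norm]
        linarith [(hN k hk l hl t ⟨ht, le_rfl⟩).1]
      have hU : CauchySeq fun k => U k t := by
        rw [Metric.cauchySeq_iff]
        intro ε hε
        obtain ⟨N, hN⟩ := hcauchy t ht (ε / 2) (by positivity)
        refine ⟨N, fun k hk l hl => ?_⟩
        rw [dist_eq_norm]
        linarith [(hN k hk l hl t ⟨ht, le_rfl⟩).2]
      obtain ⟨x, hx⟩ := cauchySeq_tendsto_of_complete hX
      obtain ⟨u, hu⟩ := cauchySeq_tendsto_of_complete hU
      exact ⟨x, u, fun _ => ⟨hx, hu⟩⟩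
    · exact ⟨0, 0, fun h => absurd h ht⟩
  choose x u hxu using hlim
  refine ⟨x, u, fun T hT => ?_⟩
  obtain ⟨R, hR, h⟩ := happrox T hT
  refine ⟨R, hR, fun ε hε => ?_⟩
  obtain ⟨N, hN⟩ := hcauchy T hT (ε / 2) (by positivity)
  obtain ⟨k, hk, hkN⟩ := ((h (ε / 2) (by positivity)).and (eventually_ge_atTop N)).exists
  refine ⟨X k, U k, X' k, U' k, hk.mono (by linarith), fun t ht => ?_⟩
  have hX : ‖X k t - x t‖ ≤ ε / 2 :=
    le_of_tendsto ((hxu t ht.1).1.const_sub (X k t)).norm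
      ((eventually_ge_atTop N).mono fun l hl => (hN k hkN l hl t ht).1)
  have hU : ‖U k t - u t‖ ≤ ε / 2 :=
    le_of_tendsto ((hxu t ht.1).2.const_sub (U k t)).norm
      ((eventually_ge_atTop N).mono fun l hl => (hN k hkN l hl t ht).2)
  have hX' := hk.left_near t ht
  have hU' := hk.right_near t ht
  rw [norm_sub_rev] at hX' hU'
  have e1 := norm_sub_le_norm_sub_add_norm_sub (X' k t) (X k t) (x t)
  have e2 := norm_sub_le_norm_sub_add_norm_sub (U' k t) (U k t) (u t)
  refine ⟨by linarith, by linarith, by linarith, by linarith⟩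

variable {s : H → H} {F : H → H → H} {x₀ x₁ : H} {x u : ℝ → H}

theorem IsApproxLimit.init (h : IsApproxLimit s F x₀ x₁ x u) : x 0 = x₀ ∧ u 0 = x₁ := by
  obtain ⟨R, -, h⟩ := h 0 le_rfl
  have key : ∀ ε : ℝ, 0 < ε → ‖x₀ - x 0‖ ≤ 0 + ε ∧ ‖x₁ - u 0‖ ≤ 0 + ε := by
    intro ε hε
    obtain ⟨X, U, X', U', hX, hlim⟩ := h ε hε
    have := hlim 0 ⟨le_rfl, le_rfl⟩
    rw [hX.left_init, hX.right_init] at this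
    simpa using ⟨this.1, this.2.1⟩
  have h1 := le_of_forall_pos_le_add fun ε hε => (key ε hε).1
  have h2 := le_of_forall_pos_le_add fun ε hε => (key ε hε).2
  exact ⟨(sub_eq_zero.1 (norm_le_zero_iff.1 h1)).symm, (sub_eq_zero.1 (norm_le_zero_iff.1 h2)).symm⟩

/-- The forces are bounded by the same `R` for all approximants, so every `U`, and hence the limit,
is `R`-Lipschitz. -/
theorem IsApproxLimit.lipschitz (h : IsApproxLimit s F x₀ x₁ x u) {T : ℝ} (hT : 0 ≤ T) :
    ∃ K : NNReal, LipschitzOnWith K u (Icc 0 T) := by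
  obtain ⟨R, hR, h⟩ := h T hT
  refine ⟨R.toNNReal, LipschitzOnWith.of_dist_le_mul ?_⟩
  have key : ∀ a ∈ Icc 0 T, ∀ b ∈ Icc 0 T, a ≤ b → ‖u b - u a‖ ≤ R * (b - a) := by
    intro a ha b hb hab
    refine le_of_forall_pos_le_add fun ε hε => ?_
    obtain ⟨X, U, X', U', hX, hlim⟩ := h (ε / 2) (by positivity)
    have h1 : ‖U b - U a‖ ≤ R * (b - a) := by
      refine norm_image_sub_le_of_norm_deriv_right_le_segment
        (hX.right_cont.mono (Icc_subset_Icc ha.1 hb.2))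
        (fun t ht => hX.right_deriv t ⟨ha.1.trans ht.1, ht.2.trans_le hb.2⟩) (fun t ht => ?_) b
        ⟨hab, le_rfl⟩
      rw [norm_neg]
      exact hX.force_bdd t ⟨ha.1.trans ht.1, ht.2.le.trans hb.2⟩
    have h2 := (hlim a ha).2.1
    have h3 := (hlim b hb).2.1
    have : u b - u a = (U b - U a) - (U b - u b) + (U a - u a) := by abel
    rw [this]
    refine (norm_add_le _ _).trans ((add_le_add_left (norm_sub_le _ _) _).trans ?_)
    linarith
  intro a ha b hb
  rw [dist_eq_norm, Real.dist_eq, Real.coe_toNNReal R hR]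
  rcases le_total a b with hab | hab
  · rw [norm_sub_rev, abs_sub_comm, abs_of_nonneg (sub_nonneg.2 hab)]
    exact key a ha b hb hab
  · rw [abs_of_nonneg (sub_nonneg.2 hab)]
    exact key b hb a ha hab

theorem IsApproxLimit.continuousOn (h : IsApproxLimit s F x₀ x₁ x u) :
    ContinuousOn u (Ici 0) := by
  intro t ht
  have ht : 0 ≤ t := ht
  obtain ⟨K, hK⟩ := h.lipschitz (T := t + 1) (by linarith)
  refine (hK.continuousOn t ⟨ht, by linarith⟩).mono_of_mem_nhdsWithin ?_
  rw [← Ici_inter_Iic]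
  exact inter_mem self_mem_nhdsWithin (mem_nhdsWithin_of_mem_nhds (Iic_mem_nhds (by linarith)))

/-- The approximants have right derivative `U'`, uniformly close to the continuous `u`. The mean
value inequality for `X t - t • u c` passes to the limit. -/
theorem IsApproxLimit.hasDerivWithinAt (h : IsApproxLimit s F x₀ x₁ x u) {c : ℝ} (hc : 0 ≤ c) :
    HasDerivWithinAt x (u c) (Ici 0) c := by
  obtain ⟨R, hR, h'⟩ := h (c + 1) (by linarith)
  have key : ∀ ε : ℝ, 0 < ε → ∀ a ∈ Icc 0 (c + 1), ∀ b ∈ Icc 0 (c + 1), a ≤ b →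
      (∀ t ∈ Icc a b, ‖u t - u c‖ ≤ ε) → ‖x b - x a - (b - a) • u c‖ ≤ ε * (b - a) := by
    intro ε hε a ha b hb hab hu
    refine le_of_forall_pos_le_add fun η hη => ?_
    set ρ := η / (2 + (b - a))
    have hba : 0 ≤ b - a := sub_nonneg.2 hab
    have hρ : 0 < ρ := by positivity
    obtain ⟨X, U, X', U', hX, hlim⟩ := h' ρ hρ
    have h1 : ‖(X b - b • u c) - (X a - a • u c)‖ ≤ (ε + ρ) * (b - a) := by
      refine norm_image_sub_le_of_norm_deriv_right_le_segment (f := fun t => X t - t • u c)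
        (f' := fun t => U' t - u c)
        ((hX.left_cont.mono (Icc_subset_Icc ha.1 hb.2)).sub (by fun_prop))
        (fun t ht => ?_) (fun t ht => ?_) b ⟨hab, le_rfl⟩
      · have := (hasDerivAt_id t).smul_const (u c)
        rw [one_smul] at this
        exact (hX.left_deriv t ⟨ha.1.trans ht.1, ht.2.trans_le hb.2⟩).sub this.hasDerivWithinAt
      · have e1 := hu t (Ico_subset_Icc_self ht)
        have e2 := (hlim t ⟨ha.1.trans ht.1, ht.2.le.trans hb.2⟩).2.2.2
        linarith [norm_sub_le_norm_sub_add_norm_sub (U' t) (u t) (u c)]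
    have h2 := (hlim a ha).1
    have h3 := (hlim b hb).1
    have : x b - x a - (b - a) • u c =
        ((X b - b • u c) - (X a - a • u c)) - (X b - x b) + (X a - x a) := by
      rw [sub_smul]; abel
    rw [this]
    refine (norm_add_le _ _).trans ((add_le_add_left (norm_sub_le _ _) _).trans ?_)
    have : ρ * (2 + (b - a)) = η := div_mul_cancel₀ _ (by positivity)
    linarith
  rw [hasDerivWithinAt_iff_isLittleO, Asymptotics.isLittleO_iff]
  intro ε hε
  have hcont := (h.continuousOn c hc)
  obtain ⟨δ, hδ, hball⟩ := Metric.continuousWithinAt_iff.1 hcont ε hε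
  have hnhds : Metric.ball c (min δ 1) ∈ 𝓝 c := Metric.ball_mem_nhds _ (by positivity)
  filter_upwards [self_mem_nhdsWithin, mem_nhdsWithin_of_mem_nhds hnhds] with t ht0 ht
  have ht0 : 0 ≤ t := ht0
  rw [Metric.mem_ball, Real.dist_eq, lt_min_iff] at ht
  have ht1 := abs_lt.1 ht.2
  have hclose : ∀ τ : ℝ, 0 ≤ τ → |τ - c| ≤ |t - c| → ‖u τ - u c‖ ≤ ε := by
    intro τ hτ hτc
    rw [← dist_eq_norm]
    exact (hball (show τ ∈ Ici 0 from hτ) (by rw [Real.dist_eq]; linarith)).le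
  rcases le_total c t with hct | htc
  · rw [Real.norm_eq_abs, abs_of_nonneg (sub_nonneg.2 hct)]
    refine key ε hε c ⟨hc, by linarith⟩ t ⟨ht0, by linarith⟩ hct fun τ hτ => hclose τ
      (hc.trans hτ.1) ?_
    rw [abs_of_nonneg (sub_nonneg.2 hτ.1), abs_of_nonneg (sub_nonneg.2 hct)]
    linarith [hτ.2]
  · rw [Real.norm_eq_abs, abs_of_nonpos (sub_nonpos.2 htc), neg_sub]
    have := key ε hε t ⟨ht0, by linarith⟩ c ⟨hc, by linarith⟩ htc fun τ hτ => hclose τ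
      (ht0.trans hτ.1) ?_
    · have hneg : x t - x c - (t - c) • u c = -(x c - x t - (c - t) • u c) := by
        rw [sub_smul, sub_smul]; abel
      rwa [hneg, norm_neg]
    · rw [abs_of_nonpos (sub_nonpos.2 hτ.2), abs_of_nonpos (sub_nonpos.2 htc)]
      linarith [hτ.1]

/-- At points of differentiability of the velocity, a limit of approximate solutions satisfies
the differential inclusion. -/
theorem IsApproxLimit.mem_subdifferential {φ : H → ℝ} (hφ : Continuous φ)
    (hs : ∀ u, s u ∈ subdifferential φ u) (hF : Continuous fun p : H × H => F p.1 p.2)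
    (h : IsApproxLimit s F x₀ x₁ x u) {c : ℝ} (hc : 0 < c) {w : H} (hw : HasDerivAt u w c) :
    -w - F (x c) (u c) ∈ subdifferential φ (u c) := by
  intro v
  -- Tested against `v`, the inclusion reads `⟪u - v, u̇⟫ ≤ Γ(x, u)`, with `Γ` continuous and free
  -- of `s`.
  let Γ : H × H → ℝ := fun p => φ v - φ p.2 + inner ℝ (F p.1 p.2) (v - p.2)
  have hΓ : Continuous Γ :=
    (continuous_const.sub (hφ.comp continuous_snd)).add
      (hF.inner (continuous_const.sub continuous_snd))
  obtain ⟨R, hR, h'⟩ := h (c + 1) (by linarith)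
  have hcont : ContinuousWithinAt (fun t => (x t, u t)) (Ici 0) c :=
    (h.hasDerivWithinAt hc.le).continuousWithinAt.prodMk (h.continuousOn c hc.le)
  -- This is the inequality integrated over `[c, b]`; it involves no derivative of `u`, so only
  -- uniform convergence is needed.
  have key : ∀ ε : ℝ, 0 < ε → ∀ᶠ b in 𝓝[>] c,
      ‖u b - v‖ ^ 2 - ‖u c - v‖ ^ 2 ≤ 2 * (Γ (x c, u c) + ε) * (b - c) := by
    intro ε hε
    obtain ⟨η, hη, hηΓ⟩ := Metric.continuous_iff.1 hΓ (x c, u c) (ε / 2) (by positivity)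
    obtain ⟨δ, hδ, hball⟩ := Metric.continuousWithinAt_iff.1 hcont (η / 2) (by positivity)
    filter_upwards [Ioo_mem_nhdsGT (show c < c + min δ 1 by simp [hδ])] with b hb
    have hbδ : b < c + δ := hb.2.trans_le (by gcongr; exact min_le_left _ _)
    have hb1 : b < c + 1 := hb.2.trans_le (by gcongr; exact min_le_right _ _)
    have happ : ∀ ρ : ℝ, 0 < ρ → ρ < η / 2 → R * ρ ≤ ε / 2 → ∃ p q : H, ‖p - u b‖ ≤ ρ ∧
        ‖q - u c‖ ≤ ρ ∧ ‖p - v‖ ^ 2 - ‖q - v‖ ^ 2 ≤ 2 * (Γ (x c, u c) + ε) * (b - c) := by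
      intro ρ hρ hρη hRρ
      obtain ⟨X, U, X', U', hX, hlim⟩ := h' ρ hρ
      refine ⟨U b, U c, (hlim b ⟨by linarith [hb.1], hb1.le⟩).2.1,
        (hlim c ⟨hc.le, by linarith⟩).2.1, ?_⟩
      have hder : ∀ t ∈ Ico c b, HasDerivWithinAt (fun t => ‖U t - v‖ ^ 2)
          (2 * inner ℝ (U t - v) (-(s (U' t) + F (X' t) (U' t)))) (Ici t) t := fun t ht =>
        ((hX.right_deriv t ⟨hc.le.trans ht.1, ht.2.trans hb1⟩).sub_const v).norm_sq
      have hB : ∀ t : ℝ, HasDerivAt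
          (fun t => ‖U c - v‖ ^ 2 + 2 * (Γ (x c, u c) + ε) * (t - c))
          (2 * (Γ (x c, u c) + ε)) t := by
        intro t
        simpa using (((hasDerivAt_id t).sub_const c).const_mul
          (2 * (Γ (x c, u c) + ε))).const_add (‖U c - v‖ ^ 2)
      have := image_le_of_deriv_right_le_deriv_boundary
        (((hX.right_cont.mono (Icc_subset_Icc hc.le hb1.le)).sub continuousOn_const).norm.pow 2)
        hder (B := fun t => ‖U c - v‖ ^ 2 + 2 * (Γ (x c, u c) + ε) * (t - c)) (by simp)
        (fun t _ => (hB t).continuousAt.continuousWithinAt)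
        (fun t _ => (hB t).hasDerivWithinAt) ?_ ⟨hb.1.le, le_rfl⟩
      · change ‖U b - v‖ ^ 2 ≤ _ at this
        linarith
      · intro t ht
        have htT : t ∈ Icc 0 (c + 1) := ⟨hc.le.trans ht.1, (ht.2.trans hb1).le⟩
        have e1 : inner ℝ (U' t - v) (-(s (U' t) + F (X' t) (U' t))) ≤ Γ (X' t, U' t) := by
          have := hs (U' t) v
          rw [← neg_sub v (U' t), inner_neg_neg, real_inner_comm, inner_add_left]
          simp only [Γ]
          linarith
        have e2 : inner ℝ (U t - U' t) (-(s (U' t) + F (X' t) (U' t))) ≤ R * ρ := by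
          refine (real_inner_le_norm _ _).trans ?_
          rw [norm_neg, mul_comm]
          exact mul_le_mul (hX.force_bdd t htT) (hX.right_near t htT) (norm_nonneg _) hR
        have e3 : Γ (X' t, U' t) ≤ Γ (x c, u c) + ε / 2 := by
          have hd1 : dist (X' t, U' t) (x t, u t) ≤ ρ := by
            rw [Prod.dist_eq, dist_eq_norm, dist_eq_norm]
            exact max_le (hlim t htT).2.2.1 (hlim t htT).2.2.2
          have hd2 : dist (x t, u t) (x c, u c) < η / 2 := by
            refine hball (show t ∈ Ici 0 from htT.1) ?_
            rw [Real.dist_eq, abs_of_nonneg (sub_nonneg.2 ht.1)]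
            linarith [ht.2]
          have := hηΓ (X' t, U' t) ((dist_triangle _ _ _).trans_lt (by linarith))
          rw [Real.dist_eq] at this
          linarith [(abs_lt.1 this).2]
        have e4 : U t - v = (U t - U' t) + (U' t - v) := by abel
        rw [e4, inner_add_left]
        linarith
    -- The point `b` was fixed independently of the accuracy `ρ`, so `ρ → 0` is allowed. The two
    -- caps give `ρ < η / 2` and `R * ρ ≤ ε / 2`.
    let ρ : ℕ → ℝ := fun n => min (η / 4) (ε / (2 * (R + 1))) / (n + 1)
    have hρ0 : 0 < min (η / 4) (ε / (2 * (R + 1))) := by positivity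
    have hρ : Tendsto ρ atTop (𝓝 0) := 
      tendsto_const_nhds.div_atTop (tendsto_natCast_atTop_atTop.atTop_add tendsto_const_nhds)
    have hρle : ∀ n, ρ n ≤ min (η / 4) (ε / (2 * (R + 1))) := fun n =>
      div_le_self hρ0.le (by linarith [n.cast_nonneg (α := ℝ)])
    have happ' : ∀ n, _ := fun n => happ (ρ n) (by positivity)
      (by linarith [(hρle n).trans (min_le_left _ _)]) (by
        have := (hρle n).trans (min_le_right _ _)
        rw [le_div_iff₀ (by positivity)] at this
        have : 0 < ρ n := by positivity
        nlinarith)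
    choose p q hp hq hpq using happ'
    have hp' : Tendsto p atTop (𝓝 (u b)) :=
      tendsto_iff_norm_sub_tendsto_zero.2 (squeeze_zero (fun _ => norm_nonneg _) hp hρ)
    have hq' : Tendsto q atTop (𝓝 (u c)) :=
      tendsto_iff_norm_sub_tendsto_zero.2 (squeeze_zero (fun _ => norm_nonneg _) hq hρ)
    exact le_of_tendsto (((hp'.sub_const v).norm.pow 2).sub ((hq'.sub_const v).norm.pow 2))
      (Eventually.of_forall hpq)
  have hder := (hw.sub_const v).norm_sq
  have hslope := (hasDerivAt_iff_tendsto_slope.1 hder).mono_left (nhdsGT_le_nhdsNE c)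
  have hle : inner ℝ (u c - v) w ≤ Γ (x c, u c) := by
    refine le_of_forall_pos_le_add fun ε hε => ?_
    have : 2 * inner ℝ (u c - v) w ≤ 2 * (Γ (x c, u c) + ε) := by
      refine le_of_tendsto hslope ?_
      filter_upwards [key ε hε, self_mem_nhdsWithin] with b hb hcb
      have hcb : c < b := hcb
      rw [slope_def_field, div_le_iff₀ (by linarith)]
      exact hb
    linarith
  rw [inner_sub_left, inner_neg_left]
  rw [← neg_sub v, inner_neg_left, real_inner_comm] at hle
  simp only [Γ] at hle
  linarith

theorem IsApproxLimit.velocity_eq (h : IsApproxLimit s F x₀ x₁ x u) : EqOn (velocity x) u (Ici 0) := fun t ht =>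
  (h.hasDerivWithinAt ht).derivWithin (uniqueDiffOn_Ici 0 t ht)

end ApproxSolution

/-! ### Existence and uniqueness of the strong solution. -/

section Main

variable {H : Type*} [NormedAddCommGroup H] [InnerProductSpace ℝ H] [CompleteSpace H]

theorem IsDampingPotential.exists_selection {φ : H → ℝ} (hφ : IsDampingPotential φ) :
    ∃ s : H → H, (∀ u, s u ∈ subdifferential φ u) ∧
      ∀ R : ℝ, ∃ M : ℝ, 0 ≤ M ∧ ∀ u, ‖u‖ ≤ R → ‖s u‖ ≤ M := by
  choose s hs using exists_isMinimalSection hφ.convex hφ.continuous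
  refine ⟨s, fun u => (hs u).1, fun R => ?_⟩
  -- The radius `|R| + 1` is positive whatever the sign of `R`.
  obtain ⟨M, hM⟩ := hφ.bdd_minimalSection (|R| + 1) (by positivity)
  refine ⟨|M|, abs_nonneg M, fun u hu => ?_⟩
  exact (hM ⟨u, s u, by linarith [le_abs_self R], hs u, rfl⟩).trans (le_abs_self M)

/-- The admissible step size depends on `T`, so a single sequence of Euler polygons serves every
horizon only eventually. -/
theorem exists_isApproxLimit_smoothForce {f φ : H → ℝ} {β : ℝ} (hβ : 0 ≤ β)
    (hf_convex : ConvexOn ℝ univ f) (hf_C2 : ContDiff ℝ 2 f) (hf_bdd : BddBelow (range f))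
    (hf_grad : LipschitzOnBoundedSets (gradient f)) (hF : LipschitzOnBalls (smoothForce f β))
    (hφ : IsDampingPotential φ) {s : H → H} (hs : ∀ u, s u ∈ subdifferential φ u)
    (hs_bdd : ∀ R : ℝ, ∃ M : ℝ, 0 ≤ M ∧ ∀ u, ‖u‖ ≤ R → ‖s u‖ ≤ M) (x₀ x₁ : H) :
    ∃ x u : ℝ → H, IsApproxLimit s (smoothForce f β) x₀ x₁ x u := by
  let h : ℕ → ℝ := fun k => 1 / ((k : ℝ) + 1)
  have hpos : ∀ k, 0 < h k := fun k => Nat.one_div_pos_of_nat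
  have hlim : Tendsto h atTop (𝓝 0) := tendsto_one_div_add_atTop_nhds_zero_nat
  refine exists_isApproxLimit hs hF x₀ x₁
    (fun k => polygon (h k) fun n => (euler s (smoothForce f β) (h k) x₀ x₁ n).1)
    (fun k => polygon (h k) fun n => (euler s (smoothForce f β) (h k) x₀ x₁ n).2)
    (fun k t => (euler s (smoothForce f β) (h k) x₀ x₁ ⌊t / h k⌋₊).1)
    (fun k t => (euler s (smoothForce f β) (h k) x₀ x₁ ⌊t / h k⌋₊).2) fun T hT => ?_
  obtain ⟨R, h₀, hR, hh₀, hbdd⟩ := exists_euler_bound hβ hf_convex hf_C2 hf_bdd hf_grad hF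
    (fun u => hφ.map_zero ▸ hφ.nonneg u) hs hs_bdd x₀ x₁ hT
  obtain ⟨M₁, hM₁, hsM⟩ := hs_bdd R
  obtain ⟨M₂, hM₂, hFM⟩ := hF.exists_bound R
  -- This constant bounds the forces as well as the states.
  refine ⟨R + M₁ + M₂, by positivity, fun ε hε => ?_⟩
  have hlim' : Tendsto (fun k => h k * (R + M₁ + M₂)) atTop (𝓝 0) := by
    simpa using hlim.mul_const (R + M₁ + M₂)
  filter_upwards [hlim.eventually_le_const hh₀, hlim'.eventually_le_const hε] with k hk hk'
  refine (isApproxSolution_polygon (hpos k) fun n hn => ?_).mono hk'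
  obtain ⟨hx, hu⟩ := hbdd (h k) (hpos k) hk n hn
  have h1 := hsM _ hu
  have h2 := hFM _ _ hx hu
  exact ⟨by linarith, by linarith, (norm_add_le _ _).trans (by linarith)⟩

theorem IsApproxLimit.isStrongGlobalSolution {f φ : H → ℝ} {β : ℝ} {s : H → H}
    (hφ : Continuous φ) (hs : ∀ u, s u ∈ subdifferential φ u)
    (hF : LipschitzOnBalls (smoothForce f β)) {x₀ x₁ : H} {x u : ℝ → H}
    (h : IsApproxLimit s (smoothForce f β) x₀ x₁ x u) : IsStrongGlobalSolution f φ β x := by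
  have hvel := h.velocity_eq
  have hlip : ∀ T : ℝ, 0 < T → ∃ K : NNReal, LipschitzOnWith K (velocity x) (Icc 0 T) := by
    intro T hT
    obtain ⟨K, hK⟩ := h.lipschitz hT.le
    refine ⟨K, fun a ha b hb => ?_⟩
    rw [hvel ha.1, hvel hb.1]
    exact hK ha hb
  refine ⟨?_, hlip, fun T hT => ?_, ?_⟩
  · rw [contDiffOn_one_iff_derivWithin (uniqueDiffOn_Ici 0)]
    exact ⟨fun t ht => (h.hasDerivWithinAt ht).differentiableWithinAt,
      h.continuousOn.congr hvel⟩
  · obtain ⟨K, hK⟩ := hlip T hT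
    refine memLp_top_of_bound (stronglyMeasurable_deriv _).aestronglyMeasurable K ?_
    filter_upwards [ae_restrict_mem measurableSet_Ioo] with t ht
    exact norm_deriv_le_of_lipschitzOn (Icc_mem_nhds ht.1 ht.2) hK
  · have hdiff : ∀ᵐ t : ℝ, ∀ n : ℕ, t ∈ Ioo (0 : ℝ) (n + 1) → DifferentiableAt ℝ (velocity x) t := by
      rw [ae_all_iff]
      intro n
      obtain ⟨K, hK⟩ := hlip (n + 1) (by positivity)
      exact hK.ae_differentiableAt_hilbert
    filter_upwards [hdiff] with t ht ht0
    obtain ⟨n, hn⟩ := exists_nat_gt t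
    have hd := ht n ⟨ht0, by linarith⟩
    -- The equation forces this `ξ`; its membership in `∂φ` is the limit inequality.
    refine ⟨hd, -acceleration x t - smoothForce f β (x t) (u t), ?_, ?_⟩
    · rw [hvel ht0.le]
      refine h.mem_subdifferential hφ hs hF.continuous ht0 (hd.hasDerivAt.congr_of_eventuallyEq ?_)
      filter_upwards [Ioi_mem_nhds ht0] with τ hτ using (hvel (mem_Ici.2 hτ.le)).symm
    · rw [hvel ht0.le, smoothForce]
      abel

theorem IsStrongGlobalSolution.hasDerivWithinAt {f φ : H → ℝ} {β : ℝ} {x : ℝ → H}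
    (hx : IsStrongGlobalSolution f φ β x) {t : ℝ} (ht : 0 ≤ t) :
    HasDerivWithinAt x (velocity x t) (Ici 0) t :=
  (hx.contDiffOn.differentiableOn (by norm_num) t ht).hasDerivWithinAt

theorem IsStrongGlobalSolution.exists_bound {f φ : H → ℝ} {β : ℝ} {x : ℝ → H}
    (hx : IsStrongGlobalSolution f φ β x) {T : ℝ} (hT : 0 < T) :
    ∃ R : ℝ, ∀ t ∈ Icc 0 T, ‖x t‖ ≤ R ∧ ‖velocity x t‖ ≤ R := by
  obtain ⟨K, hK⟩ := hx.lipschitz_velocity T hT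
  obtain ⟨R₁, h₁⟩ := isCompact_Icc.exists_bound_of_continuousOn
    (hx.contDiffOn.continuousOn.mono (Icc_subset_Ici_self : Icc 0 T ⊆ Ici 0))
  obtain ⟨R₂, h₂⟩ := isCompact_Icc.exists_bound_of_continuousOn hK.continuousOn
  exact ⟨max R₁ R₂, fun t ht =>
    ⟨(h₁ t ht).trans (le_max_left _ _), (h₂ t ht).trans (le_max_right _ _)⟩⟩

/-- Two strong solutions with the same Cauchy data coincide. -/
theorem IsStrongGlobalSolution.eqOn {f φ : H → ℝ} {β : ℝ}
    (hF : LipschitzOnBalls (smoothForce f β)) {x y : ℝ → H}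
    (hx : IsStrongGlobalSolution f φ β x) (hy : IsStrongGlobalSolution f φ β y)
    (h0 : x 0 = y 0) (h1 : velocity x 0 = velocity y 0) : EqOn x y (Ici 0) := by
  intro T hT
  rcases (mem_Ici.1 hT).eq_or_lt with rfl | hT
  · exact h0
  obtain ⟨R₁, hR₁⟩ := hx.exists_bound hT
  obtain ⟨R₂, hR₂⟩ := hy.exists_bound hT
  set R := max R₁ R₂
  obtain ⟨L, hL, hLip⟩ := hF R
  set K := 2 + 6 * L
  obtain ⟨K₁, hK₁⟩ := hx.lipschitz_velocity T hT
  obtain ⟨K₂, hK₂⟩ := hy.lipschitz_velocity T hT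
  have hIcc : uIcc 0 T = Icc 0 T := uIcc_of_le hT.le
  have hnorm : ∀ (g g' : ℝ → H) (A A' : NNReal), LipschitzOnWith A g (Icc 0 T) →
      LipschitzOnWith A' g' (Icc 0 T) →
      AbsolutelyContinuousOnInterval (fun t => ‖g t - g' t‖ ^ 2) 0 T := by
    intro g g' A A' hg hg'
    rw [← hIcc] at hg hg'
    have h := (lipschitzWith_one_norm.comp_lipschitzOnWith
      (hg.sub hg')).absolutelyContinuousOnInterval
    simpa only [sq, Function.comp_apply] using h.fun_mul h
  let D : ℝ → ℝ := fun t => ‖x t - y t‖ ^ 2 + ‖velocity x t - velocity y t‖ ^ 2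
  -- The velocities are differentiable only almost everywhere, so Gronwall is run on `exp(-K t)
  -- D(t)`: absolute continuity and an almost everywhere nonpositive derivative give `D T ≤ 0`.
  have hac : AbsolutelyContinuousOnInterval (fun t => Real.exp (-K * t) * D t) 0 T := by
    have hreg : ∀ {z : ℝ → H}, IsStrongGlobalSolution f φ β z →
        ∃ A, LipschitzOnWith A z (Icc 0 T) := fun hz =>
      (hz.contDiffOn.mono Icc_subset_Ici_self).exists_lipschitzOnWith one_ne_zero
        (convex_Icc 0 T) isCompact_Icc
    obtain ⟨A₁, hA₁⟩ := hreg hx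
    obtain ⟨A₂, hA₂⟩ := hreg hy
    have hexp : ContDiff ℝ 1 fun t => Real.exp (-K * t) := by fun_prop
    exact hexp.contDiffOn.absolutelyContinuousOnInterval.fun_mul
      ((hnorm x y A₁ A₂ hA₁ hA₂).fun_add (hnorm _ _ K₁ K₂ hK₁ hK₂))
  have hderiv : ∀ᵐ t : ℝ, t ∈ Ioc 0 T → deriv (fun t => Real.exp (-K * t) * D t) t ≤ 0 := by
    filter_upwards [hx.inclusion, hy.inclusion] with t htx hty ht
    obtain ⟨hdx, p, hp, hpx⟩ := htx ht.1
    obtain ⟨hdy, q, hq, hqy⟩ := hty ht.1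
    have htI : t ∈ Icc 0 T := Ioc_subset_Icc_self ht
    have hIci : Ici (0 : ℝ) ∈ 𝓝 t := Ici_mem_nhds ht.1
    have hDd : HasDerivAt D _ t :=
      (((hx.hasDerivWithinAt ht.1.le).hasDerivAt hIci).sub
        ((hy.hasDerivWithinAt ht.1.le).hasDerivAt hIci)).norm_sq.add
        (hdx.hasDerivAt.sub hdy.hasDerivAt).norm_sq
    have hE : HasDerivAt (fun t => Real.exp (-K * t)) (Real.exp (-K * t) * (-K)) t := by
      simpa using ((hasDerivAt_id t).const_mul (-K)).exp
    rw [(hE.fun_mul hDd).deriv]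
    have hax : deriv (velocity x) t = -(p + smoothForce f β (x t) (velocity x t)) := by
      rw [eq_neg_iff_add_eq_zero, smoothForce, ← hpx, acceleration]; abel
    have hay : deriv (velocity y) t = -(q + smoothForce f β (y t) (velocity y t)) := by
      rw [eq_neg_iff_add_eq_zero, smoothForce, ← hqy, acceleration]; abel
    -- Exact solutions have no evaluation error; with `σ = 0` the force bound drops out, so it may
    -- depend on `t`.
    have hle := inner_approx_le (σ := 0) hL le_rfl (by norm_num)
      (R := max ‖p + smoothForce f β (x t) (velocity x t)‖
        ‖q + smoothForce f β (y t) (velocity y t)‖) hp hq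
      (hLip (x t) (y t) (velocity x t) (velocity y t)
        ((hR₁ t htI).1.trans (le_max_left _ _)) ((hR₂ t htI).1.trans (le_max_right _ _))
        ((hR₁ t htI).2.trans (le_max_left _ _)) ((hR₂ t htI).2.trans (le_max_right _ _)))
      (x := x t) (y := y t) (u := velocity x t) (v := velocity y t) (by simp) (by simp)
      (le_max_left _ _) (le_max_right _ _)
    rw [← hax, ← hay, mul_zero, add_zero] at hle
    have hexp := Real.exp_pos (-K * t)
    have := mul_le_mul_of_nonneg_left hle hexp.le
    simp only [D, Pi.sub_apply] at this ⊢
    linarith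
  have hint := hac.integral_deriv_eq_sub
  have hint' : ∫ t in (0 : ℝ)..T, deriv (fun t => Real.exp (-K * t) * D t) t ≤ 0 := by
    rw [intervalIntegral.integral_of_le hT.le]
    refine integral_nonpos_of_ae ?_
    exact (ae_restrict_iff' measurableSet_Ioc).2 hderiv
  have hD0 : D 0 = 0 := by simp [D, h0, h1]
  rw [hint, hD0, mul_zero, sub_zero] at hint'
  have hDT : D T ≤ 0 := nonpos_of_mul_nonpos_right hint' (Real.exp_pos _)
  have h2 : ‖x T - y T‖ ^ 2 ≤ 0 := by
    have : 0 ≤ ‖velocity x T - velocity y T‖ ^ 2 := by positivity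
    simp only [D] at hDT
    linarith
  exact sub_eq_zero.1 (norm_eq_zero.1 (pow_eq_zero_iff two_ne_zero |>.1
    (le_antisymm h2 (by positivity))))

end Main

theorem mainTheorem8 {H : Type*} [NormedAddCommGroup H] [InnerProductSpace ℝ H] [CompleteSpace H]
    (f φ : H → ℝ) (β : ℝ) (hβ : 0 ≤ β)
    (hf_convex : ConvexOn ℝ univ f) (hf_C2 : ContDiff ℝ 2 f) (hf_bdd : BddBelow (range f))
    (hf_grad : LipschitzOnBoundedSets (gradient f))
    (hf_hess : LipschitzOnBoundedSets (hessian f))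
    (hφ : IsDampingPotential φ) (x₀ x₁ : H) :
    (∃ x : ℝ → H, IsStrongGlobalSolution f φ β x ∧ x 0 = x₀ ∧ velocity x 0 = x₁) ∧
    (∀ x y : ℝ → H,
      IsStrongGlobalSolution f φ β x → x 0 = x₀ → velocity x 0 = x₁ →
      IsStrongGlobalSolution f φ β y → y 0 = x₀ → velocity y 0 = x₁ →
      EqOn x y (Ici 0)) := by
  have hF := lipschitzOnBalls_smoothForce β hf_grad hf_hess
  refine ⟨?_, fun x y hx hx0 hx1 hy hy0 hy1 =>
    hx.eqOn hF hy (hx0.trans hy0.symm) (hx1.trans hy1.symm)⟩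
  obtain ⟨s, hs, hs_bdd⟩ := hφ.exists_selection
  obtain ⟨x, u, h⟩ := exists_isApproxLimit_smoothForce hβ hf_convex hf_C2 hf_bdd hf_grad hF hφ hs
    hs_bdd x₀ x₁
  refine ⟨x, h.isStrongGlobalSolution hφ.continuous hs hF, h.init.1, ?_⟩
  rw [h.velocity_eq (mem_Ici.2 le_rfl), h.init.2]
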